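/- Let $\beta\mathbb N$ be the space of ultrafilters on $\mathbb N$, with basic open sets $\{\mathcal U : A\in\mathcal U\}$, $A\subseteq\mathbb N$, and let $\mathbb N^*=\beta\mathbb N\setminus\mathbb N$ be the subspace of free ultrafilters. Let $\tau:\mathbb N^*\to\mathbb N^*$ be the homeomorphism obtained by restricting the continuous extension to $\beta\mathbb N$ of $n\mapsto n+1$. Let $\Omega^*$ be the quotient space of $\mathbb N^*\times[0,1]$ by the identifications $(\mathcal U,1)\sim(\tau\,\mathcal U,0)$, $\mathcal U\in\mathbb N^*$, and for $s\in\mathbb R$ define $\tau^s:\Omega^*\to\Omega^*$ by $$\tau^s(\mathcal U,t)=\bigl(\tau^{\lfloor t+s\rfloor}\,\mathcal U,\ t+s-\lfloor t+s\rfloor\bigr).$$ Let $\mathcal R_-$ be the set of all $\omega\in\Omega^*$ whose negative semi-orbit is recurrent, i.e. such that for every neighborhood $V$ of $\omega$ and every real $R>0$ there is $s\ge R$ with $\tau^{-s}\omega\in V$. For $\omega=(\mathcal U,t)\in\Omega^*$ and $\theta=2^t$, define the charge (finitely additive measure) $\nu_\omega$ on the power set $\mathcal P(\mathbb N)$ by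 $$\nu_\omega(A)=\mathcal U\text{-}\lim_{n}\frac{|A\cap[1,\lfloor\theta\cdot 2^n\rfloor]|}{\theta\cdot 2^n},\qquad A\subseteq\mathbb N,$$ where $\mathcal U\text{-}\lim$ is the limit along the ultrafilter $\mathcal U$; this does not depend on the representative $(\mathcal U,t)$ of $\omega$. A charge $\mu$ on a field $\mathscr F$ of subsets of a set $X$ has the additive property if for every $\varepsilon>0$ and every increasing sequence $A_1\subseteq A_2\subseteq\cdots$ in $\mathscr F$ there is $B\in\mathscr F$ such that $\mu(B)\le\lim_{i\to\infty}\mu(A_i)+\varepsilon$ and $\mu(A_i\setminus B)=0$ for every $i$. **Theorem 5.3.** For every $\omega\in\Omega^*$, the charge $\nu_\omega$ has the additive property if and only if $\omega\notin\mathcal R_-$. -/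

import Mathlib

noncomputable section

open Set Filter Topology

namespace DensityCharge

/-! ### Charges and the additive property -/

/-- A (nonnegative, real-valued, hence bounded) charge on a field `𝓕` of subsets of `X`; only the
values of `μ` on members of `𝓕` matter. -/
structure IsCharge {X : Type*} (𝓕 : Set (Set X)) (μ : Set X → ℝ) : Prop where
  isSetAlgebra : MeasureTheory.IsSetAlgebra 𝓕
  nonneg : ∀ A ∈ 𝓕, 0 ≤ μ A
  empty : μ ∅ = 0
  union : ∀ A ∈ 𝓕, ∀ B ∈ 𝓕, A ∩ B = ∅ → μ (A ∪ B) = μ A + μ B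

/-- The additive property of a charge `μ` on `𝓕`: for every `ε > 0` and every increasing sequence
`A` in `𝓕` there is `B ∈ 𝓕` with `μ B ≤ lim μ (A i) + ε` and `μ (A i \ B) = 0` for all `i`. -/
def HasAdditiveProperty {X : Type*} (𝓕 : Set (Set X)) (μ : Set X → ℝ) : Prop :=
  ∀ ε : ℝ, 0 < ε → ∀ A : ℕ → Set X, (∀ i, A i ∈ 𝓕) → Monotone A →
    ∃ B ∈ 𝓕, (∃ l : ℝ, Tendsto (fun i => μ (A i)) atTop (𝓝 l) ∧ μ B ≤ l + ε) ∧
      ∀ i, μ (A i \ B) = 0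

/-! ### The shift on `ℕ* = βℕ \ ℕ`

`βℕ` is the space of ultrafilters on `ℕ`, with the topology generated by the sets `{U | A ∈ U}`;
`ℕ` is embedded through principal ultrafilters. -/

/-- `ℕ*`: the non-principal ultrafilters on `ℕ`, with the relative topology of `βℕ`. -/
abbrev NStar : Type := {U : Ultrafilter ℕ // U ∉ range (pure : ℕ → Ultrafilter ℕ)}

/-- The map `τ : βℕ → βℕ` induced by `n ↦ n + 1`. -/
def shiftBeta (U : Ultrafilter ℕ) : Ultrafilter ℕ := U.map (fun n => n + 1)

/-- `shiftBeta` extends `n ↦ n + 1`. -/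
theorem shiftBeta_pure (n : ℕ) : shiftBeta (pure n) = pure (n + 1) := rfl

/-- `shiftBeta` is continuous, so it is the continuous extension of `n ↦ n + 1` to `βℕ`. -/
theorem continuous_shiftBeta : Continuous shiftBeta := by
  refine ultrafilterBasis_is_basis.continuous_iff.2 ?_
  rintro _ ⟨s, rfl⟩
  exact ultrafilter_isOpen_basic ((fun n => n + 1) ⁻¹' s)

theorem compl_singleton_mem (U : NStar) (n : ℕ) : ({n}ᶜ : Set ℕ) ∈ U.1 := by
  rw [Ultrafilter.compl_mem_iff_notMem]
  intro h
  refine U.2 ⟨n, ?_⟩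
  refine (Ultrafilter.coe_le_coe.1 ?_).symm
  rw [Ultrafilter.coe_pure]
  exact Filter.le_pure_iff.2 h

theorem range_succ_mem (U : NStar) : range (fun n : ℕ => n + 1) ∈ U.1 := by
  refine mem_of_superset (compl_singleton_mem U 0) ?_
  intro n hn
  exact ⟨n - 1, Nat.succ_pred_eq_of_ne_zero hn⟩

/-- The inverse of the shift on `ℕ*`. -/
def unshift (U : NStar) : Ultrafilter ℕ :=
  U.1.comap (add_left_injective 1) (range_succ_mem U)

theorem shiftBeta_unshift (U : NStar) : shiftBeta (unshift U) = U.1 := by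
  refine Ultrafilter.coe_injective ?_
  simp only [shiftBeta, unshift, Ultrafilter.coe_map, Ultrafilter.coe_comap]
  exact Filter.map_comap_of_mem (range_succ_mem U)

theorem shiftBeta_injective : Function.Injective shiftBeta := by
  intro U V h
  refine Ultrafilter.coe_injective ?_
  have h' := congrArg (fun W : Ultrafilter ℕ => (W : Filter ℕ)) h
  simp only [shiftBeta, Ultrafilter.coe_map] at h'
  exact Filter.map_injective (add_left_injective 1) h'

theorem shiftBeta_notMem (U : NStar) :
    shiftBeta U.1 ∉ range (pure : ℕ → Ultrafilter ℕ) := by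
  rintro ⟨n, hn⟩
  have h : ({n}ᶜ : Set ℕ) ∈ shiftBeta U.1 := by
    refine Ultrafilter.mem_map.2 (mem_of_superset (compl_singleton_mem U (n - 1)) ?_)
    intro k hk hk'
    have : k + 1 = n := hk'
    exact hk (by simp; omega)
  rw [← hn] at h
  exact (Ultrafilter.mem_pure.1 h) rfl

theorem unshift_notMem (U : NStar) : unshift U ∉ range (pure : ℕ → Ultrafilter ℕ) := by
  rintro ⟨n, hn⟩
  refine U.2 ⟨n + 1, ?_⟩
  rw [← shiftBeta_unshift U, ← hn, shiftBeta_pure]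

/-- The shift as a bijection of `ℕ*`. -/
def tauEquiv : NStar ≃ NStar where
  toFun U := ⟨shiftBeta U.1, shiftBeta_notMem U⟩
  invFun U := ⟨unshift U, unshift_notMem U⟩
  left_inv _ := Subtype.ext (shiftBeta_injective (shiftBeta_unshift _))
  right_inv U := Subtype.ext (shiftBeta_unshift U)

theorem continuous_tauEquiv : Continuous tauEquiv :=
  (continuous_shiftBeta.comp continuous_subtype_val).subtype_mk _

theorem continuous_tauEquiv_symm : Continuous tauEquiv.symm := by
  refine Continuous.subtype_mk (ultrafilterBasis_is_basis.continuous_iff.2 ?_) _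
  rintro _ ⟨s, rfl⟩
  have : unshift ⁻¹' {u | s ∈ u} = {U : NStar | (fun n => n + 1) '' s ∈ U.1} := by
    ext U
    exact Ultrafilter.mem_comap U.1 (add_left_injective 1) (range_succ_mem U)
  rw [this]
  exact (ultrafilter_isOpen_basic ((fun n => n + 1) '' s)).preimage continuous_subtype_val

/-- The homeomorphism `τ : ℕ* → ℕ*`. -/
def tau : NStar ≃ₜ NStar where
  toEquiv := tauEquiv
  continuous_toFun := continuous_tauEquiv
  continuous_invFun := continuous_tauEquiv_symm

/-! ### The suspension and its flow -/

/-- The identification `(U, 1) ∼ (τ U, 0)` on `ℕ* × [0, 1]`. -/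
inductive SuspRel : NStar × unitInterval → NStar × unitInterval → Prop
  | glue (U : NStar) : SuspRel (U, 1) (tau U, 0)

/-- `Ω*`: the quotient of `ℕ* × [0, 1]` by the equivalence relation generated by `SuspRel`. -/
def OmegaStar : Type := Quot SuspRel

/-- The quotient topology on `Ω*`. -/
instance : TopologicalSpace OmegaStar := inferInstanceAs (TopologicalSpace (Quot SuspRel))

/-- The class in `Ω*` of a pair `(U, t)`. -/
def OmegaStar.mk (U : NStar) (t : unitInterval) : OmegaStar := Quot.mk SuspRel (U, t)

/-- The fractional part as a point of `[0, 1]`. -/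
def fractI (x : ℝ) : unitInterval := ⟨Int.fract x, Int.fract_nonneg x, (Int.fract_lt_one x).le⟩

/-- `τ^s : Ω* → Ω*`, `τ^s (U, t) = (τ^⌊t+s⌋ U, t + s - ⌊t+s⌋)`. -/
def flow (s : ℝ) : OmegaStar → OmegaStar :=
  Quot.lift (fun p => OmegaStar.mk ((tau ^ ⌊(p.2 : ℝ) + s⌋) p.1) (fractI ((p.2 : ℝ) + s))) (by
    rintro _ _ ⟨U⟩
    have h1 : ⌊(1 : ℝ) + s⌋ = ⌊s⌋ + 1 := by rw [add_comm, Int.floor_add_one]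
    have h2 : fractI ((1 : ℝ) + s) = fractI s := by
      apply Subtype.ext
      simp [fractI]
    simp only [Set.Icc.coe_one, Set.Icc.coe_zero, zero_add, h1, h2]
    rw [zpow_add_one]
    rfl)

/-- `R_-`: the points `ω` of `Ω*` whose negative semi-orbit `{τ^{-s} ω : s ≥ 0}` is recurrent. -/
def recurrentSet : Set OmegaStar :=
  {ω | ∀ V ∈ 𝓝 ω, ∀ R : ℝ, 0 < R → ∃ s : ℝ, R ≤ s ∧ flow (-s) ω ∈ V}

/-! ### The density measures `ν_ω` -/

/-- The limit of a real sequence along an ultrafilter (it exists for bounded sequences, see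
`tendsto_uLim`). -/
def uLim (U : Ultrafilter ℕ) (f : ℕ → ℝ) : ℝ := limUnder (U : Filter ℕ) f

theorem tendsto_uLim (U : Ultrafilter ℕ) (f : ℕ → ℝ) (a b : ℝ) (h : ∀ n, f n ∈ Icc a b) :
    Tendsto f U (𝓝 (uLim U f)) := by
  obtain ⟨x, -, hx⟩ := isCompact_Icc.ultrafilter_le_nhds (U.map f)
    (le_principal_iff.2 (Filter.mem_map.2 (Filter.univ_mem' h)) :
      ((U.map f : Ultrafilter ℝ) : Filter ℝ) ≤ 𝓟 (Icc a b))
  exact tendsto_nhds_limUnder ⟨x, hx⟩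

/-- `|A ∩ [1, ⌊θ 2^n⌋]| / (θ 2^n)` with `θ = 2^t`. -/
def ratio (t : ℝ) (A : Set ℕ) (n : ℕ) : ℝ :=
  ((A ∩ Icc 1 ⌊(2 : ℝ) ^ t * 2 ^ n⌋₊).ncard : ℝ) / ((2 : ℝ) ^ t * 2 ^ n)

/-- `ν_ω (A) = U-lim_n |A ∩ [1, ⌊θ 2^n⌋]| / (θ 2^n)` for `ω = (U, t)` and `θ = 2^t`. -/
def nu (ω : OmegaStar) (A : Set ℕ) : ℝ :=
  Quot.lift (fun p : NStar × unitInterval => uLim p.1.1 (ratio (p.2 : ℝ) A)) (by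
    rintro _ _ ⟨U⟩
    have h : ratio 1 A = ratio 0 A ∘ (fun n => n + 1) := by
      funext n
      simp only [ratio, Function.comp, Real.rpow_one, Real.rpow_zero, one_mul, pow_succ']
    simp only [Set.Icc.coe_one, Set.Icc.coe_zero, h]
    rfl) ω

theorem ratio_mem (t : ℝ) (A : Set ℕ) (n : ℕ) : ratio t A n ∈ Icc (0 : ℝ) 1 := by
  have hpos : (0 : ℝ) < (2 : ℝ) ^ t * 2 ^ n := by positivity
  refine ⟨by unfold ratio; positivity, ?_⟩
  unfold ratio
  rw [div_le_one hpos]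
  refine le_trans ?_ (Nat.floor_le hpos.le)
  refine Nat.cast_le.2 ?_
  refine (ncard_le_ncard inter_subset_right (finite_Icc _ _)).trans ?_
  rw [ncard_eq_toFinset_card']
  simp

/-- `ν_ω` is a charge on the power set of `ℕ`. -/
theorem isCharge_nu (ω : OmegaStar) : IsCharge univ (nu ω) := by
  obtain ⟨⟨U, t⟩, rfl⟩ := Quot.exists_rep ω
  have key : ∀ A, Tendsto (ratio t A) U.1 (𝓝 (nu (Quot.mk _ (U, t)) A)) := fun A =>
    tendsto_uLim U.1 _ 0 1 (ratio_mem t A)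
  refine ⟨⟨trivial, fun _ _ => trivial, fun _ _ _ _ => trivial⟩, ?_, ?_, ?_⟩
  · intro A _
    exact ge_of_tendsto' (key A) fun n => (ratio_mem t A n).1
  · refine tendsto_nhds_unique (key ∅) ?_
    have : ratio t ∅ = fun _ => 0 := by funext n; simp [ratio]
    rw [this]
    exact tendsto_const_nhds
  · intro A _ B _ hAB
    refine tendsto_nhds_unique (key (A ∪ B)) ?_
    have : ratio t (A ∪ B) = fun n => ratio t A n + ratio t B n := by
      funext n
      have hd : Disjoint (A ∩ Icc 1 ⌊(2 : ℝ) ^ (t : ℝ) * 2 ^ n⌋₊)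
          (B ∩ Icc 1 ⌊(2 : ℝ) ^ (t : ℝ) * 2 ^ n⌋₊) :=
        (disjoint_iff_inter_eq_empty.2 hAB).mono inter_subset_left inter_subset_left
      simp only [ratio]
      rw [union_inter_distrib_right, ncard_union_eq hd ((finite_Icc _ _).inter_of_right _)
        ((finite_Icc _ _).inter_of_right _), Nat.cast_add, add_div]
    rw [this]
    exact (key A).add (key B)

end DensityCharge

end

namespace DensityCharge

open Set Filter Topology

/-! Integer times of the flow fix the `t`-coordinate, so membership in `recurrentSet` depends only
on the return of `U` under inverse shifts (`mk_mem_recurrentSet_iff`).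

If `U` is not recurrent, it contains a set `X` in which, along `U`, the gap before `n` exceeds every
bound (`exists_gap_mem`). Cut ℕ at the points `cutoff t n`, `n ∈ X`: the density at `n` then sees
only the block ending at `n`. Blocks can be filled independently, so a diagonal `B` that follows a
later and later `A i` has the required properties.

If `U` is recurrent, let `A i` omit the dyadic blocks with index in a set `Z i ∈ U` fixing residues
modulo `1, ..., i + 1`; then `ν (A i) ≤ 1/2`. A candidate `B` leaves complement of positive density
at `n - m` for `U`-many `n` and one fixed `m ≥ 1`. For `n ∈ Z i` with `i` large, `A i` contains the
last blocks before `n - m`, so `A i \ B` has positive charge. -/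

/-! ### Recurrence of a free ultrafilter under the inverse shift -/

/-- `X` returns to the ultrafilter under arbitrarily large shifts. -/
def ShiftRecurrent (U : Ultrafilter ℕ) : Prop :=
  ∀ X ∈ U, ∀ M : ℕ, ∃ m, M ≤ m ∧ {n | m ≤ n ∧ n - m ∈ X} ∈ U

theorem mem_tau_iff (U : NStar) (X : Set ℕ) : X ∈ (tau U).1 ↔ {n | n + 1 ∈ X} ∈ U.1 :=
  Iff.rfl

theorem mem_tau_pow_iff (m : ℕ) (U : NStar) (X : Set ℕ) :
    X ∈ ((tau ^ m) U).1 ↔ {n | n + m ∈ X} ∈ U.1 := by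
  induction m generalizing X with
  | zero => rfl
  | succ m ih =>
    rw [pow_succ']
    change X ∈ (tau ((tau ^ m) U)).1 ↔ _
    rw [mem_tau_iff, ih]
    simp only [mem_ofPred_eq, add_assoc]

theorem mem_tau_zpow_neg_iff (m : ℕ) (U : NStar) (X : Set ℕ) :
    X ∈ ((tau ^ (-(m : ℤ))) U).1 ↔ {n | m ≤ n ∧ n - m ∈ X} ∈ U.1 := by
  have h : (tau ^ m) ((tau ^ (-(m : ℤ))) U) = U := by
    rw [zpow_neg, zpow_natCast]
    exact DFunLike.congr_fun (mul_inv_cancel (tau ^ m)) U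
  conv_rhs => rw [← h]
  rw [mem_tau_pow_iff]
  simp

theorem OmegaStar.exists_rep_lt_one (ω : OmegaStar) :
    ∃ (U : NStar) (t : unitInterval), (t : ℝ) < 1 ∧ ω = OmegaStar.mk U t := by
  obtain ⟨⟨U, t⟩, rfl⟩ := Quot.exists_rep ω
  rcases t.2.2.lt_or_eq with h | h
  · exact ⟨U, t, h, rfl⟩
  · have : t = 1 := Subtype.ext h
    subst this
    exact ⟨tau U, 0, by simp, Quot.sound (SuspRel.glue U)⟩

theorem flow_mk (s : ℝ) (U : NStar) (t : unitInterval) :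
    flow s (OmegaStar.mk U t) =
      OmegaStar.mk ((tau ^ ⌊(t : ℝ) + s⌋) U) (fractI ((t : ℝ) + s)) := rfl

/-- The saturated predicate on the suspension describing the union of the open cylinders around
the fibre over `X`. -/
def suspNhd (X : Set ℕ) : Set OmegaStar :=
  {ω | Quot.lift (fun p : NStar × unitInterval =>
      (p.2 < 1 ∧ X ∈ p.1.1) ∨ (0 < p.2 ∧ X ∈ (tau p.1).1)) (by
    rintro _ _ ⟨U⟩
    simp) ω}

theorem mk_mem_suspNhd (X : Set ℕ) (U : NStar) (t : unitInterval) :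
    OmegaStar.mk U t ∈ suspNhd X ↔ (t < 1 ∧ X ∈ U.1) ∨ (0 < t ∧ X ∈ (tau U).1) := Iff.rfl

theorem isOpen_suspNhd (X : Set ℕ) : IsOpen (suspNhd X) := by
  have hq : IsQuotientMap (Quot.mk SuspRel) := isQuotientMap_quot_mk
  refine hq.isOpen_preimage.1 ?_
  have hX : IsOpen {U : NStar | X ∈ U.1} :=
    (ultrafilter_isOpen_basic X).preimage continuous_subtype_val
  have h1 : IsOpen {p : NStar × unitInterval | p.2 < 1 ∧ X ∈ p.1.1} :=
    (isOpen_lt continuous_snd continuous_const).inter (hX.preimage continuous_fst)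
  have h2 : IsOpen {p : NStar × unitInterval | 0 < p.2 ∧ X ∈ (tau p.1).1} :=
    (isOpen_lt continuous_const continuous_snd).inter
      (hX.preimage (tau.continuous.comp continuous_fst))
  exact h1.union h2

theorem continuous_mk_left (t : unitInterval) :
    Continuous fun U : NStar => OmegaStar.mk U t :=
  (continuous_quot_mk (r := SuspRel)).comp (Continuous.prodMk_left t)

/-- Forward, `suspNhd X` ignores the position along the fibre, so real return times yield integer
shifts. Backward, integer times return to the same slice, where a neighborhood contains a basic set
given by some `X`. -/
theorem mk_mem_recurrentSet_iff (U : NStar) (t : unitInterval) (ht : (t : ℝ) < 1) :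
    OmegaStar.mk U t ∈ recurrentSet ↔ ShiftRecurrent U.1 := by
  constructor
  · intro h X hX M
    have hV : suspNhd X ∈ 𝓝 (OmegaStar.mk U t) :=
      (isOpen_suspNhd X).mem_nhds (Or.inl ⟨ht, hX⟩)
    obtain ⟨s, hs, hmem⟩ := h _ hV (M + 2) (by positivity)
    rw [flow_mk, mk_mem_suspNhd] at hmem
    have hfl : ⌊(t : ℝ) + -s⌋ < -((M : ℤ)) := by
      rw [Int.floor_lt]
      push_cast
      linarith
    rcases hmem with ⟨-, hm⟩ | ⟨-, hm⟩
    · obtain ⟨m, hm'⟩ : ∃ m : ℕ, ⌊(t : ℝ) + -s⌋ = -(m : ℤ) :=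
        ⟨(-⌊(t : ℝ) + -s⌋).toNat, by omega⟩
      rw [hm', mem_tau_zpow_neg_iff] at hm
      exact ⟨m, by omega, hm⟩
    -- Here `X` is met on the far side of the gluing, one shift later.
    · obtain ⟨m, hm'⟩ : ∃ m : ℕ, ⌊(t : ℝ) + -s⌋ = -1 + -(m : ℤ) :=
        ⟨(-⌊(t : ℝ) + -s⌋ - 1).toNat, by omega⟩
      have hcomp : tau ((tau ^ (-1 + -(m : ℤ))) U) = (tau ^ (-(m : ℤ))) U := by
        change (tau * tau ^ (-1 + -(m : ℤ))) U = _
        rw [← zpow_one_add]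
        congr 2
        ring
      rw [hm', hcomp, mem_tau_zpow_neg_iff] at hm
      exact ⟨m, by omega, hm⟩
  · intro h V hV R _
    have hpre := (continuous_mk_left t).continuousAt.preimage_mem_nhds hV
    rw [nhds_subtype_eq_comap, mem_comap] at hpre
    obtain ⟨O, hO, hOV⟩ := hpre
    obtain ⟨_, ⟨X, rfl⟩, hUX, hXO⟩ := ultrafilterBasis_is_basis.mem_nhds_iff.1 hO
    obtain ⟨m, hm, hmem⟩ := h X hUX ⌈R⌉₊
    refine ⟨m, Nat.ceil_le.1 hm, ?_⟩
    have hfl : ⌊(t : ℝ) + -(m : ℝ)⌋ = -(m : ℤ) := by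
      rw [Int.floor_eq_iff]
      push_cast
      constructor <;> linarith [t.2.1]
    have hfr : fractI ((t : ℝ) + -(m : ℝ)) = t := by
      refine Subtype.ext ?_
      simp only [fractI, Int.fract, hfl]
      push_cast
      ring
    rw [flow_mk, hfl, hfr]
    exact hOV (hXO ((mem_tau_zpow_neg_iff m U X).2 hmem))

/-! ### Free ultrafilters: residues and sparse members -/

theorem NStar.eventually_ge (U : NStar) (N : ℕ) : ∀ᶠ n in (U.1 : Filter ℕ), N ≤ n := by
  induction N with
  | zero => simp
  | succ N ih =>
    filter_upwards [ih, compl_singleton_mem U N] with n h1 h2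
    have : n ≠ N := h2
    omega

theorem exists_residue_mem (U : Ultrafilter ℕ) {M : ℕ} (hM : 0 < M) :
    ∃ c, ∀ᶠ n in (U : Filter ℕ), n % M = c := by
  have h : (⋃ c ∈ Iio M, {n : ℕ | n % M = c}) ∈ U := by
    refine mem_of_superset univ_mem fun n _ => ?_
    simp [Nat.mod_lt n hM]
  obtain ⟨c, -, hc⟩ := (Ultrafilter.finite_biUnion_mem_iff (finite_Iio M)).1 h
  exact ⟨c, hc⟩

/-- Non-recurrence excludes only shifts `m ≥ M`; keeping one residue class modulo `M + 1` excludes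
`0 < m < M` too. -/
theorem exists_sparse_mem (U : Ultrafilter ℕ) (h : ¬ ShiftRecurrent U) :
    ∃ X ∈ U, ∀ m, 0 < m → ∀ᶠ n in (U : Filter ℕ), m ≤ n → n - m ∉ X := by
  unfold ShiftRecurrent at h
  push Not at h
  obtain ⟨X, hX, M, hM⟩ := h
  obtain ⟨c, hc⟩ := exists_residue_mem U (Nat.succ_pos M)
  refine ⟨X ∩ {n | n % (M + 1) = c}, inter_mem hX hc, fun m hm => ?_⟩
  rcases le_or_gt M m with hMm | hMm
  · filter_upwards [Ultrafilter.compl_mem_iff_notMem.2 (hM m hMm)] with n hn hmn hx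
    exact hn ⟨hmn, hx.1⟩
  · filter_upwards [hc] with n hn hmn hx
    have h1 : n ≡ n - m [MOD M + 1] := hn.trans hx.2.symm
    have h2 := Nat.le_of_dvd (by omega) ((Nat.modEq_iff_dvd' (Nat.sub_le n m)).1 h1.symm)
    omega

theorem exists_gap_mem (U : NStar) (h : ¬ ShiftRecurrent U.1) :
    ∃ X ∈ U.1, ∀ K, ∀ᶠ n in (U.1 : Filter ℕ), ∀ k ∈ X, k < n → k + K < n := by
  obtain ⟨X, hX, hs⟩ := exists_sparse_mem U.1 h
  refine ⟨X, hX, fun K => ?_⟩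
  have hall : ∀ᶠ n in (U.1 : Filter ℕ), ∀ m ∈ Icc 1 K, m ≤ n → n - m ∉ X :=
    (eventually_all_finite (finite_Icc 1 K)).2 fun m hm => hs m hm.1
  filter_upwards [hall] with n hn k hk hkn
  by_contra hc
  refine hn (n - k) ⟨by omega, by omega⟩ (by omega) ?_
  rwa [Nat.sub_sub_self hkn.le]

/-! ### Truncation points and blocks -/

/-- The truncation points `⌊θ 2^n⌋`, `θ = 2^t`. -/
noncomputable def cutoff (t : ℝ) (n : ℕ) : ℕ := ⌊(2 : ℝ) ^ t * 2 ^ n⌋₊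

theorem cutoff_mono (t : ℝ) : Monotone (cutoff t) := fun a b h =>
  Nat.floor_mono (mul_le_mul_of_nonneg_left (pow_le_pow_right₀ one_le_two h) (by positivity))

theorem cutoff_le (t : ℝ) (n : ℕ) : (cutoff t n : ℝ) ≤ (2 : ℝ) ^ t * 2 ^ n :=
  Nat.floor_le (by positivity)

/-- The least `n ∈ X` with `x ≤ ⌊θ 2^n⌋`. -/
noncomputable def nextCut (t : ℝ) (X : Set ℕ) (x : ℕ) : ℕ := sInf {n | n ∈ X ∧ x ≤ cutoff t n}

theorem nextCut_le {t : ℝ} {X : Set ℕ} {x n : ℕ} (hn : n ∈ X) (hx : x ≤ cutoff t n) :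
    nextCut t X x ≤ n := Nat.sInf_le ⟨hn, hx⟩

theorem nextCut_spec {t : ℝ} {X : Set ℕ} {x n : ℕ} (hn : n ∈ X) (hx : x ≤ cutoff t n) :
    nextCut t X x ∈ X ∧ x ≤ cutoff t (nextCut t X x) :=
  Nat.sInf_mem (s := {n | n ∈ X ∧ x ≤ cutoff t n}) ⟨n, hn, hx⟩

/-- The initial segment up to `cutoff t k` has at most `2^(k - n)` of the normalizing mass `θ 2^n`.
-/
theorem ratio_le_add {t : ℝ} {A A' : Set ℕ} {n k m : ℕ} (hkm : k + m ≤ n)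
    (h : ∀ x ∈ A, x ≤ cutoff t n → x ∈ A' ∨ x ≤ cutoff t k) :
    ratio t A n ≤ ratio t A' n + (1 / 2) ^ m := by
  have hpos : (0 : ℝ) < (2 : ℝ) ^ t * 2 ^ n := by positivity
  have hsub : A ∩ Icc 1 (cutoff t n) ⊆ (A' ∩ Icc 1 (cutoff t n)) ∪ Icc 1 (cutoff t k) := by
    rintro x ⟨hxA, hx1, hxn⟩
    exact (h x hxA hxn).imp (fun hx => ⟨hx, hx1, hxn⟩) fun hx => ⟨hx1, hx⟩
  have hcard := (ncard_le_ncard hsub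
    (((finite_Icc _ _).inter_of_right _).union (finite_Icc _ _))).trans (ncard_union_le _ _)
  have hIcc : (Icc 1 (cutoff t k)).ncard = cutoff t k := by
    rw [ncard_eq_toFinset_card']
    simp
  rw [hIcc] at hcard
  have hcard' : ((A ∩ Icc 1 (cutoff t n)).ncard : ℝ) ≤
      (A' ∩ Icc 1 (cutoff t n)).ncard + (2 : ℝ) ^ t * 2 ^ k :=
    (Nat.cast_le.2 hcard).trans (by push_cast; linarith [cutoff_le t k])
  have hpow : (2 : ℝ) ^ k ≤ (1 / 2) ^ m * 2 ^ n := by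
    obtain ⟨d, rfl⟩ := Nat.exists_eq_add_of_le hkm
    have h1 : (1 / 2 : ℝ) ^ m * 2 ^ (k + m + d) = 2 ^ k * 2 ^ d := by
      rw [pow_add, pow_add, one_div, inv_pow]
      field_simp
    rw [h1]
    exact le_mul_of_one_le_right (by positivity) (one_le_pow₀ one_le_two)
  have hθ : (0 : ℝ) < (2 : ℝ) ^ t := by positivity
  change _ / _ ≤ _ / _ + _
  rw [div_add' _ _ _ hpos.ne']
  refine div_le_div_of_nonneg_right (hcard'.trans ?_) hpos.le
  have h2 := mul_le_mul_of_nonneg_left hpow hθ.le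
  simp only [cutoff]
  linarith

theorem ratio_mono {t : ℝ} {A A' : Set ℕ} (h : A ⊆ A') (n : ℕ) : ratio t A n ≤ ratio t A' n :=
  div_le_div_of_nonneg_right (Nat.cast_le.2 (ncard_le_ncard (inter_subset_inter_left _ h)
    ((finite_Icc _ _).inter_of_right _))) (by positivity)

/-- Passing from `⌊θ 2^k⌋` to the later truncation point `⌊θ 2^n⌋`. -/
theorem ratio_le_of_subset_initial {t : ℝ} {A A' : Set ℕ} {k n : ℕ} (m : ℕ) (hkm : n = k + m)
    (h : ∀ x ∈ A, x ≤ cutoff t k → x ∈ A') : ratio t A k ≤ 2 ^ m * ratio t A' n := by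
  subst hkm
  have hsub : A ∩ Icc 1 (cutoff t k) ⊆ A' ∩ Icc 1 (cutoff t (k + m)) := by
    rintro x ⟨hxA, hx1, hxk⟩
    exact ⟨h x hxA hxk, hx1, hxk.trans (cutoff_mono t (Nat.le_add_right k m))⟩
  have hcard : ((A ∩ Icc 1 (cutoff t k)).ncard : ℝ) ≤ (A' ∩ Icc 1 (cutoff t (k + m))).ncard :=
    Nat.cast_le.2 (ncard_le_ncard hsub ((finite_Icc _ _).inter_of_right _))
  have h2 : (2 : ℝ) ^ m * ratio t A' (k + m) =
      ((A' ∩ Icc 1 (cutoff t (k + m))).ncard : ℝ) / ((2 : ℝ) ^ t * 2 ^ k) := by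
    unfold ratio cutoff
    rw [pow_add]
    field_simp
  rw [h2]
  exact div_le_div_of_nonneg_right hcard (by positivity)

theorem tendsto_ratio (U : NStar) (t : unitInterval) (A : Set ℕ) :
    Tendsto (ratio t A) U.1 (𝓝 (nu (OmegaStar.mk U t) A)) :=
  tendsto_uLim U.1 _ 0 1 (ratio_mem t A)

theorem nu_mono (ω : OmegaStar) {A A' : Set ℕ} (h : A ⊆ A') : nu ω A ≤ nu ω A' := by
  obtain ⟨⟨U, t⟩, rfl⟩ := Quot.exists_rep ω
  exact le_of_tendsto_of_tendsto' (tendsto_ratio U t A) (tendsto_ratio U t A') (ratio_mono h)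

theorem nu_le_one (ω : OmegaStar) (A : Set ℕ) : nu ω A ≤ 1 := by
  obtain ⟨⟨U, t⟩, rfl⟩ := Quot.exists_rep ω
  exact le_of_tendsto' (tendsto_ratio U t A) fun n => (ratio_mem t A n).2

theorem nu_le_of_eventually {U : NStar} {t : unitInterval} {A : Set ℕ} {a : ℝ}
    (h : ∀ᶠ n in (U.1 : Filter ℕ), ratio t A n ≤ a) : nu (OmegaStar.mk U t) A ≤ a :=
  le_of_tendsto (tendsto_ratio U t A) h

theorem nu_univ (ω : OmegaStar) : nu ω univ = 1 := by
  obtain ⟨⟨U, t⟩, rfl⟩ := Quot.exists_rep ω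
  refine tendsto_nhds_unique (tendsto_ratio U t univ) ?_
  have htop : Tendsto (fun n : ℕ => (2 : ℝ) ^ (t : ℝ) * 2 ^ n) U.1 atTop := by
    have hU : (U.1 : Filter ℕ) ≤ atTop := by
      intro s hs
      obtain ⟨N, hN⟩ := mem_atTop_sets.1 hs
      exact mem_of_superset (NStar.eventually_ge U N) hN
    exact ((tendsto_pow_atTop_atTop_of_one_lt one_lt_two).const_mul_atTop
      (by positivity)).mono_left hU
  refine (tendsto_nat_floor_div_atTop.comp htop).congr fun n => ?_
  simp only [Function.comp, ratio, univ_inter]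
  congr 2
  rw [ncard_eq_toFinset_card']
  simp

/-! ### The two implications -/

theorem hasAdditiveProperty_of_not_shiftRecurrent (U : NStar) (t : unitInterval)
    (h : ¬ ShiftRecurrent U.1) :
    HasAdditiveProperty (univ : Set (Set ℕ)) (nu (OmegaStar.mk U t)) := by
  classical
  intro ε hε A _ hA
  set ν := nu (OmegaStar.mk U t) with hν
  have hmono : Monotone fun i => ν (A i) := fun i j hij => nu_mono _ (hA hij)
  have hbdd : BddAbove (range fun i => ν (A i)) := ⟨1, by rintro _ ⟨i, rfl⟩; exact nu_le_one _ _⟩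
  set l := ⨆ i, ν (A i) with hl
  obtain ⟨X, hX, hgap⟩ := exists_gap_mem U h
  -- The cap `n` lets `idx` tend to infinity along `U`. The default value 0 is harmless, since `hev
  -- 0` makes the test hold there.
  let idx : ℕ → ℕ := fun n => Nat.findGreatest (fun i => ratio t (A i) n ≤ l + ε / 2) n
  have hev : ∀ i, ∀ᶠ n in (U.1 : Filter ℕ), ratio t (A i) n ≤ l + ε / 2 := fun i =>
    ((tendsto_ratio U t (A i)).eventually_lt_const
      (by have := le_ciSup hbdd i; simp only [hν] at this ⊢; linarith)).mono fun _ => le_of_lt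
  let B : Set ℕ := {x | x ∈ A (idx (nextCut t X x))}
  have hloc : ∀ n ∈ X, ∀ K, K ≤ n → (∀ k ∈ X, k < n → k + K < n) → ∀ x ≤ cutoff t n,
      nextCut t X x = n ∨ x ≤ cutoff t (n - K) := by
    intro n hn K hK hg x hx
    refine (nextCut_le hn hx).eq_or_lt.imp_right fun hlt => ?_
    have hs := nextCut_spec hn hx
    have := hg _ hs.1 hlt
    exact hs.2.trans (cutoff_mono t (by omega))
  refine ⟨B, trivial, ⟨l, tendsto_atTop_ciSup hmono hbdd, ?_⟩, fun i => ?_⟩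
  · obtain ⟨K, hK⟩ := exists_pow_lt_of_lt_one (half_pos hε) (one_half_lt_one (α := ℝ))
    refine nu_le_of_eventually ?_
    filter_upwards [hX, hgap K, NStar.eventually_ge U K, hev 0] with n hn hg hKn h0
    have hidx : ratio t (A (idx n)) n ≤ l + ε / 2 :=
      Nat.findGreatest_spec (P := fun i => ratio t (A i) n ≤ l + ε / 2) (Nat.zero_le n) h0
    have := ratio_le_add (t := t) (A := B) (A' := A (idx n)) (n := n) (k := n - K) (m := K)
      (by omega) fun x hxB hxn => (hloc n hn K hKn hg x hxn).imp_left fun hx => by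
        have : x ∈ A (idx (nextCut t X x)) := hxB
        rwa [hx] at this
    linarith
  · refine le_antisymm (le_of_forall_pos_le_add fun δ hδ => ?_)
      ((isCharge_nu _).nonneg _ trivial)
    obtain ⟨K, hK⟩ := exists_pow_lt_of_lt_one hδ (one_half_lt_one (α := ℝ))
    refine nu_le_of_eventually ?_
    filter_upwards [hX, hgap K, NStar.eventually_ge U K, NStar.eventually_ge U i, hev i]
      with n hn hg hKn hin hi
    -- Hence `B` contains `A i` on the last block, and only older blocks contribute to `A i \ B`.
    have hidx : i ≤ idx n := Nat.le_findGreatest hin hi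
    have := ratio_le_add (t := t) (A := A i \ B) (A' := ∅) (n := n) (k := n - K) (m := K)
      (by omega) fun x hxB hxn => (hloc n hn K hKn hg x hxn).imp_left fun hx => by
        refine hxB.2 ?_
        change x ∈ A (idx (nextCut t X x))
        rw [hx]
        exact hA hidx hxB.1
    have h0 : ratio t ∅ n = 0 := by simp [ratio]
    linarith

theorem not_hasAdditiveProperty_of_shiftRecurrent (U : NStar) (t : unitInterval)
    (h : ShiftRecurrent U.1) :
    ¬ HasAdditiveProperty (univ : Set (Set ℕ)) (nu (OmegaStar.mk U t)) := by
  intro hAP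
  have hres := fun j : ℕ => exists_residue_mem U.1 (Nat.succ_pos j)
  choose c hc using hres
  let Z : ℕ → Set ℕ := fun i => {n | ∀ j ∈ Iic i, n % (j + 1) = c j}
  have hZ : ∀ i, Z i ∈ U.1 := fun i =>
    (eventually_all_finite (finite_Iic i)).2 fun j _ => hc j
  -- With `univ`, the blocks are the dyadic ones between consecutive cutoffs.
  let A : ℕ → Set ℕ := fun i => {x | nextCut t univ x ∉ Z i}
  have hA : Monotone A := fun i j hij x hx hxZ =>
    hx fun k hk => hxZ k (le_trans hk hij)
  have hA_half : ∀ i, nu (OmegaStar.mk U t) (A i) ≤ 1 / 2 := by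
    intro i
    refine nu_le_of_eventually ?_
    filter_upwards [hZ i, NStar.eventually_ge U 1] with n hn h1
    have := ratio_le_add (t := t) (A := A i) (A' := ∅) (n := n) (k := n - 1) (m := 1)
      (by omega) fun x hx hxn => by
        refine Or.inr ?_
        have hne : nextCut t univ x ≠ n := fun he => hx (he ▸ hn)
        have hle := nextCut_le (mem_univ n) hxn
        exact (nextCut_spec (mem_univ n) hxn).2.trans (cutoff_mono t (by omega))
    have h0 : ratio t ∅ n = 0 := by simp [ratio]
    linarith
  obtain ⟨B, -, ⟨l, hl, hB⟩, hnull⟩ := hAP (1 / 4) (by norm_num) A (fun _ => trivial) hA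
  have hl_half : l ≤ 1 / 2 := le_of_tendsto' hl hA_half
  have hcompl : 1 / 8 < nu (OmegaStar.mk U t) Bᶜ := by
    have := (isCharge_nu (OmegaStar.mk U t)).union B trivial Bᶜ trivial (inter_compl_self B)
    rw [union_compl_self, nu_univ] at this
    linarith
  -- The bound 1 forces `m ≥ 1`, so block indices up to `n - m` differ from `n`.
  obtain ⟨m, hm, hret⟩ := h _ ((tendsto_ratio U t Bᶜ).eventually_const_lt hcompl) 1
  -- The modulus `m + 4` puts blocks omitted by `A (m + 3)` at or below `n - (m + 4)`, costing
  -- `1/16` of the `1/8`; passing from `n - m` to `n` divides by `2^m`.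
  have hlow : (1 / 16 : ℝ) / 2 ^ m ≤ nu (OmegaStar.mk U t) (A (m + 3) \ B) := by
    refine ge_of_tendsto (tendsto_ratio U t _) ?_
    filter_upwards [hret, hZ (m + 3), NStar.eventually_ge U (m + 4)] with n hn hnZ hn4
    obtain ⟨hmn, hbig⟩ := hn
    have hbig' : 1 / 8 < ratio t Bᶜ (n - m) := hbig
    have hstep := ratio_le_add (t := t) (A := Bᶜ) (A' := A (m + 3) \ B) (n := n - m)
      (k := n - (m + 4)) (m := 4) (by omega) fun x hx hxn => by
        by_cases hxA : x ∈ A (m + 3)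
        · exact Or.inl ⟨hxA, hx⟩
        · refine Or.inr ?_
          have hxZ : nextCut t univ x ∈ Z (m + 3) := not_not.1 hxA
          have hle := nextCut_le (mem_univ _) hxn
          have hmod : nextCut t univ x ≡ n [MOD m + 3 + 1] :=
            (hxZ (m + 3) self_mem_Iic).trans (hnZ (m + 3) self_mem_Iic).symm
          have hdvd := Nat.le_of_dvd (by omega) ((Nat.modEq_iff_dvd' (by omega)).1 hmod)
          exact (nextCut_spec (mem_univ _) hxn).2.trans (cutoff_mono t (by omega))
    have hinit := ratio_le_of_subset_initial (t := t) (A := A (m + 3) \ B) (A' := A (m + 3) \ B)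
      (k := n - m) (n := n) m (by omega) fun x hx _ => hx
    rw [div_le_iff₀ (by positivity)]
    norm_num at hstep
    linarith
  rw [hnull] at hlow
  exact absurd hlow (not_le.2 (by positivity))

end DensityCharge

theorem theorem5p3 (ω : DensityCharge.OmegaStar) :
    DensityCharge.HasAdditiveProperty (Set.univ : Set (Set ℕ)) (DensityCharge.nu ω) ↔
      ω ∉ DensityCharge.recurrentSet := by
  obtain ⟨U, t, ht, rfl⟩ := ω.exists_rep_lt_one
  rw [DensityCharge.mk_mem_recurrentSet_iff U t ht]
  exact ⟨fun h hrec => DensityCharge.not_hasAdditiveProperty_of_shiftRecurrent U t hrec h,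
    DensityCharge.hasAdditiveProperty_of_not_shiftRecurrent U t⟩
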